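/- Let $c>0$, $\lambda>0$ and $0<p<1$. Let $(X(t),Y(t))_{t\ge 0}$ be the planar random motion that starts at the origin and moves with constant speed $c$ along one of the four directions $d_j=(\cos(\pi j/2),\sin(\pi j/2))$, $j\in\mathbb{Z}/4\mathbb{Z}$; the initial direction is uniform on $\{d_0,d_1,d_2,d_3\}$, and the direction changes at the events of a homogeneous Poisson process of intensity $\lambda$, as follows, independently of the Poisson process: if the particle is moving horizontally (direction $d_0$ or $d_2$), it turns counterclockwise (from $d_j$ to $d_{j+1}$) with probability $p$ and clockwise (from $d_j$ to $d_{j-1}$) with probability $1-p$; if it is moving vertically (direction $d_1$ or $d_3$), it turns counterclockwise with probability $1-p$ and clockwise with probability $p$. Let $(U(t))_{t\ge0}$ and $(V(t))_{t\ge0}$ be two independent telegraph processes with intensities $\lambda(1-p)$ and $\lambda p$ respectively, both having velocity $\frac{c}{2}$. (A telegraph process with velocity $v$ and intensity $\mu$ is $\int_0^t v\,S\,(-1)^{N(s)}\,ds$, where $N$ is a Poisson process of intensity $\mu$ and $S$ is independent of $N$ with $\mathbb{P}(S=1)=\mathbb{P}(S=-1)=\frac12$.) Then the process $(X(t),Y(t))$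 admits the representation $$X(t)=U(t)+V(t),\qquad Y(t)=U(t)-V(t),$$ in the sense of equality in law of the two processes: $(X(t),Y(t))_{t\ge0}$ and $(U(t)+V(t),U(t)-V(t))_{t\ge0}$ have the same law (the same finite-dimensional distributions). In particular, for every $t\ge0$ and all $\alpha,\beta\in\mathbb{R}$, $$\mathbb{E}\left[e^{i\alpha X(t)+i\beta Y(t)}\right]=\mathbb{E}\left[e^{i\alpha (U(t)+V(t))+i\beta (U(t)-V(t))}\right].$$ -/

import Mathlib

open MeasureTheory ProbabilityTheory Filter Topology
open scoped NNReal

/-- `N` is a homogeneous Poisson process of intensity `r` under `P`: it starts at zero, its paths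
are almost surely nondecreasing and right-continuous, its increments are independent, and
`N t - N s` is Poisson distributed with parameter `r (t - s)` for `s ≤ t`. (As the paths are almost
surely nondecreasing, the truncated subtraction of `ℕ` is almost surely the true difference.) -/
structure IsPoissonProcess {Ω : Type*} [MeasurableSpace Ω] (N : ℝ≥0 → Ω → ℕ) (r : ℝ)
    (P : Measure Ω) : Prop where
  measurable : ∀ t, Measurable (N t)
  zero : ∀ᵐ ω ∂P, N 0 ω = 0
  monotone : ∀ᵐ ω ∂P, Monotone (fun t => N t ω)
  rightContinuous : ∀ᵐ ω ∂P, ∀ t, ContinuousWithinAt (fun s => N s ω) (Set.Ici t) t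
  indepIncrements : HasIndepIncrements N P
  law_increment : ∀ s t : ℝ≥0, s ≤ t →
    HasLaw (fun ω => N t ω - N s ω) (poissonMeasure (r * ((t : ℝ) - (s : ℝ))).toNNReal) P

/-- `U` is a (symmetric) telegraph process with velocity `v` and intensity `r` under `P`: the
position at time `t` of a particle on the line which starts at the origin, with initial velocity
`v` or `-v` with probability `1/2` each, and reverses its direction at the events of a Poisson
process of intensity `r`, independent of the initial direction. -/
def IsTelegraphProcess {Ω : Type*} [MeasurableSpace Ω] (U : ℝ≥0 → Ω → ℝ) (v r : ℝ)
    (P : Measure Ω) : Prop :=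
  ∃ (S : Ω → ℝ) (N : ℝ≥0 → Ω → ℕ),
    Measurable S ∧ P.real {ω | S ω = 1} = 1 / 2 ∧ P.real {ω | S ω = -1} = 1 / 2 ∧
    IsPoissonProcess N r P ∧
    IndepFun S (fun ω t => N t ω) P ∧
    ∀ᵐ ω ∂P, ∀ t : ℝ≥0,
      U t ω = ∫ s in (0 : ℝ)..t, v * (S ω * (-1) ^ N s.toNNReal ω)

/-- The probability of turning from the direction `d_i` into the direction `d_j` at a switch.
A particle that moves horizontally (`i = 0` or `i = 2`) turns counterclockwise with probability `p`
and clockwise with probability `1 - p`; a particle that moves vertically (`i = 1` or `i = 3`) turns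
counterclockwise with probability `1 - p` and clockwise with probability `p`. -/
def turnProb (p : ℝ) (i j : ZMod 4) : ℝ :=
  if j = i + 1 then (if i = 0 ∨ i = 2 then p else 1 - p)
  else if j = i - 1 then (if i = 0 ∨ i = 2 then 1 - p else p)
  else 0

/-- `E 0, E 1, E 2, …` are the successive directions (as indices modulo `4`) of the planar motion
under `P`: a Markov chain with uniform initial law and transition probabilities `turnProb p`. -/
structure IsDirectionChain {Ω : Type*} [MeasurableSpace Ω] (E : ℕ → Ω → ZMod 4) (p : ℝ)
    (P : Measure Ω) : Prop where
  measurable : ∀ n, Measurable (E n)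
  initial : ∀ j, P.real {ω | E 0 ω = j} = 1 / 4
  transition : ∀ (n : ℕ) (e : ℕ → ZMod 4),
    P.real {ω | ∀ k ≤ n + 1, E k ω = e k} =
      P.real {ω | ∀ k ≤ n, E k ω = e k} * turnProb p (e n) (e (n + 1))

/-- `(X, Y)` is the planar random motion with orthogonal directions
`d_j = (cos (π j / 2), sin (π j / 2))`, velocity `c`, intensity `r` and turning parameter `p` under
`P`: it starts at the origin and its direction at time `t` is `d_j` with `j = E (N t)`, where `N` is
a Poisson process of intensity `r`, which counts the direction changes, and `E` is the chain of the
successive directions, independent of `N`. -/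
def IsOrthogonalPlanarMotion {Ω : Type*} [MeasurableSpace Ω] (X Y : ℝ≥0 → Ω → ℝ) (c r p : ℝ)
    (P : Measure Ω) : Prop :=
  ∃ (E : ℕ → Ω → ZMod 4) (N : ℝ≥0 → Ω → ℕ),
    IsDirectionChain E p P ∧
    IsPoissonProcess N r P ∧
    IndepFun (fun ω n => E n ω) (fun ω t => N t ω) P ∧
    ∀ᵐ ω ∂P, ∀ t : ℝ≥0,
      X t ω = (∫ s in (0 : ℝ)..t,
        c * Real.cos (Real.pi * ((E (N s.toNNReal ω) ω).val : ℝ) / 2)) ∧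
      Y t ω = (∫ s in (0 : ℝ)..t,
        c * Real.sin (Real.pi * ((E (N s.toNNReal ω) ω).val : ℝ) / 2))

/-! In the coordinates x + y and x - y, each direction `d_j` becomes a pair of signs (u, v). Every
switch flips exactly one of them: u with probability 1 - p and v with probability p, whatever the
current direction. By Poisson thinning, u and v should therefore flip independently at rates λ(1 -
p) and λp, as the signs of two independent telegraph processes do.

The proof replaces thinning by moments. Each monomial u^k v^l is an eigenfunction of the transition
matrix (`sum_turnProb_mul`), with eigenvalue (1-p)(-1)^k + p(-1)^l. Averaging its powers over a
Poisson number of switches gives an exponential that splits into a u-factor and a v-factor. Hence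
`hasFlipMoments_planarMotion` and `hasFlipMoments_prod_telegraph` yield the same recursion in time,
and this recursion determines all mixed moments (`HasFlipMoments.integral_prod_eq`).

For ±1-valued processes these moments give the finite-dimensional characteristic functions, hence
the law on path space (`HasFlipMoments.identDistrib`). Positions are integrals of signs; writing
them as a measurable functional of the sign path (`riemannPrimitive`) carries the equality of laws
over to them. -/

/-! ### Integrals of right-continuous paths as measurable functionals -/

/-- Right-endpoint Riemann sums of a bounded right-continuous function converge to its integral. -/
theorem tendsto_riemannSum_of_rightContinuous {g : ℝ → ℝ} {C : ℝ} (hC : ∀ x, |g x| ≤ C)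
    (hg : ∀ x, 0 ≤ x → ContinuousWithinAt g (Set.Ici x) x) :
    Tendsto (fun n : ℕ => (n : ℝ)⁻¹ * ∑ k ∈ Finset.range n, g ((k + 1) / n)) atTop
      (𝓝 (∫ x in (0 : ℝ)..1, g x)) := by
  have hmeas (n : ℕ) : Measurable fun x : ℝ => g (⌈n * x⌉₊ / n) :=
    (measurable_from_nat (f := fun k : ℕ => g (k / n))).comp
      (Nat.measurable_ceil.comp (measurable_const_mul _))
  have hlim : Tendsto (fun n : ℕ => ∫ x in (0 : ℝ)..1, g (⌈n * x⌉₊ / n)) atTop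
      (𝓝 (∫ x in (0 : ℝ)..1, g x)) := by
    refine intervalIntegral.tendsto_integral_filter_of_dominated_convergence (fun _ => C)
      (.of_forall fun n => (hmeas n).aestronglyMeasurable)
      (.of_forall fun n => .of_forall fun x _ => hC _) intervalIntegrable_const
      (.of_forall fun x hx => ?_)
    rw [Set.uIoc_of_le zero_le_one] at hx
    -- The mesh point `⌈n * x⌉₊ / n` tends to `x` from the right, so one-sided continuity suffices.
    refine (hg x hx.1.le).tendsto.comp (tendsto_nhdsWithin_iff.2 ⟨?_, ?_⟩)
    · have := (tendsto_nat_ceil_mul_div_atTop hx.1.le).comp (tendsto_natCast_atTop_atTop (R := ℝ))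
      simpa [Function.comp_def, mul_comm] using this
    · filter_upwards [eventually_gt_atTop 0] with n hn
      have hn' : (0 : ℝ) < n := by exact_mod_cast hn
      rw [Set.mem_Ici, le_div_iff₀ hn', mul_comm]
      exact Nat.le_ceil _
  refine hlim.congr' ?_
  filter_upwards [eventually_gt_atTop 0] with n hn
  have hn' : (0 : ℝ) < n := by exact_mod_cast hn
  have hsum := intervalIntegral.sum_integral_adjacent_intervals (μ := volume)
    (f := fun x : ℝ => g (⌈n * x⌉₊ / n)) (a := fun k : ℕ => (k : ℝ) / n) (n := n) fun k _ => by
      rw [intervalIntegrable_iff]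
      exact Measure.integrableOn_of_bounded (M := C) (by simp) (hmeas n).aestronglyMeasurable
        (.of_forall fun x => hC _)
  simp only [Nat.cast_zero, zero_div, div_self hn'.ne'] at hsum
  rw [← hsum, Finset.mul_sum]
  refine Finset.sum_congr rfl fun k _ => ?_
  have hle : (k : ℝ) / n ≤ ((k + 1 : ℕ) : ℝ) / n := by gcongr; simp
  have hconst : ∀ x ∈ Set.Ioc ((k : ℝ) / n) (((k + 1 : ℕ) : ℝ) / n),
      g (⌈n * x⌉₊ / n) = g ((k + 1) / n) := by
    intro x hx
    have h1 : (k : ℝ) < n * x := by have := hx.1; rwa [div_lt_iff₀ hn', mul_comm] at this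
    have h2 : n * x ≤ ((k + 1 : ℕ) : ℝ) := by have := hx.2; rwa [le_div_iff₀ hn', mul_comm] at this
    have h3 : ⌈n * x⌉₊ = k + 1 := by
      rw [Nat.ceil_eq_iff (by simp)]
      exact ⟨by simpa using h1, h2⟩
    rw [h3]; push_cast; rfl
  rw [intervalIntegral.integral_of_le hle, setIntegral_congr_fun measurableSet_Ioc hconst]
  rw [setIntegral_const, Measure.real, Real.volume_Ioc,
    ENNReal.toReal_ofReal (sub_nonneg.2 hle), smul_eq_mul]
  push_cast
  congr 1
  field_simp
  ring

/-- The primitive `t ↦ ∫ s in 0..t, f s` of a path `f`, as a limit of Riemann sums, so that it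
depends measurably on `f`. -/
noncomputable def riemannPrimitive (f : ℝ≥0 → ℝ) (t : ℝ≥0) : ℝ :=
  limsup (fun n : ℕ => (t : ℝ) * ((n : ℝ)⁻¹ *
    ∑ k ∈ Finset.range n, f (t * ((k + 1) / n)))) atTop

theorem measurable_riemannPrimitive : Measurable riemannPrimitive := by
  refine measurable_pi_lambda _ fun t => Measurable.limsup fun n => ?_
  fun_prop

theorem riemannPrimitive_eq_integral {f : ℝ≥0 → ℝ} {C : ℝ} (hC : ∀ x, |f x| ≤ C)
    (hf : ∀ x, ContinuousWithinAt f (Set.Ici x) x) (t : ℝ≥0) :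
    riemannPrimitive f t = ∫ s in (0 : ℝ)..t, f s.toNNReal := by
  have key := (tendsto_riemannSum_of_rightContinuous (g := fun x => f (t * x).toNNReal)
    (fun x => hC _) fun x _ => (hf _).comp (f := fun y : ℝ => (t * y).toNNReal)
      (by fun_prop) fun y hy => by
        exact Real.toNNReal_le_toNNReal (mul_le_mul_of_nonneg_left hy t.2)).const_mul (t : ℝ)
  have h : (t : ℝ) * ∫ x in (0 : ℝ)..1, f (t * x).toNNReal = ∫ s in (0 : ℝ)..t, f s.toNNReal := by
    have := intervalIntegral.smul_integral_comp_mul_left (a := 0) (b := 1)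
      (fun s : ℝ => f s.toNNReal) (t : ℝ)
    simpa using this
  rw [← h, ← key.limsup_eq, riemannPrimitive]
  congr! 7 with n k
  rw [show (t : ℝ) * (((k : ℝ) + 1) / n) = ((t * ((k + 1) / n) : ℝ≥0) : ℝ) by push_cast; rfl,
    Real.toNNReal_coe]

/-! ### Poisson processes: independence of the past and the next increment -/

/-- Any finite set of times below `s` is visited by an increasing sequence of times that starts
at `0`, reaches `s` and stays there. -/
theorem exists_monotone_seq_through (I : Finset ℝ≥0) : ∀ s : ℝ≥0, (∀ i ∈ I, i ≤ s) →
    ∃ (τ : ℕ → ℝ≥0) (n : ℕ), Monotone τ ∧ τ 0 = 0 ∧ (∀ k, n ≤ k → τ k = s) ∧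
      ∀ i ∈ I, ∃ k, k ≤ n ∧ τ k = i := by
  induction I using Finset.induction_on_max with
  | empty =>
    intro s _
    refine ⟨fun k => if k = 0 then 0 else s, 1, ?_, by simp, ?_, by simp⟩
    · intro a b hab
      by_cases ha : a = 0
      · simp [ha]
      · have : b ≠ 0 := by omega
        simp [ha, this]
    · intro k hk
      have : k ≠ 0 := by omega
      simp [this]
  | insert m I hm ih =>
    intro s hs
    obtain ⟨τ, n, hτ, h0, hn, hI⟩ := ih m fun i hi => (hm i hi).le
    have hms : m ≤ s := hs m (Finset.mem_insert_self _ _)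
    refine ⟨fun k => if k ≤ n then τ k else s, n + 1, ?_, by simpa using h0, ?_, ?_⟩
    · intro a b hab
      by_cases hb : b ≤ n
      · simpa [hb, hab.trans hb] using hτ hab
      · by_cases ha : a ≤ n
        · simpa [ha, hb] using ((hτ ha).trans (hn n le_rfl).le).trans hms
        · simp [ha, hb]
    · intro k hk
      have : ¬ k ≤ n := by omega
      simp [this]
    · intro i hi
      rcases Finset.mem_insert.1 hi with rfl | hi
      · exact ⟨n, by omega, by simpa using hn n le_rfl⟩
      · obtain ⟨k, hk, rfl⟩ := hI i hi
        exact ⟨k, by omega, by simp [hk]⟩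

namespace IsPoissonProcess

variable {Ω : Type*} [MeasurableSpace Ω] {P : Measure Ω} {N : ℝ≥0 → Ω → ℕ} {r : ℝ}

theorem indepFun_past_increment (hN : IsPoissonProcess N r P) {s t : ℝ≥0} (hst : s ≤ t)
    (I : Finset ℝ≥0) (hI : ∀ i ∈ I, i ≤ s) :
    IndepFun (fun ω (i : I) => N i ω) (fun ω => N t ω - N s ω) P := by
  obtain ⟨τ, n, hτ, h0, hn, hmem⟩ := exists_monotone_seq_through I s hI
  -- `σ` runs through the past up to `s`, reached at index `n`, and then jumps to `t`: its increment
  -- number `n` is the one from `s` to `t`.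
  let σ : ℕ → ℝ≥0 := fun k => if k ≤ n then τ k else t
  have hσ : Monotone σ := by
    intro a b hab
    by_cases hb : b ≤ n
    · simpa [σ, hb, hab.trans hb] using hτ hab
    · by_cases ha : a ≤ n
      · simpa [σ, ha, hb] using ((hτ ha).trans (hn n le_rfl).le).trans hst
      · simp [σ, ha, hb]
  have hincr : ∀ i, Measurable fun ω => N (σ (i + 1)) ω - N (σ i) ω :=
    fun i => (hN.measurable _).sub (hN.measurable _)
  have hind := (hN.indepIncrements.nat hσ).indepFun_finset (Finset.range n) {n} (by simp) hincr
  choose κ hκn hκ using fun i : I => hmem i i.2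
  have hlast : Measurable fun x : (({n} : Finset ℕ) → ℕ) => x ⟨n, Finset.mem_singleton_self n⟩ :=
    measurable_pi_apply _
  -- Each past value is the sum of the first `κ i` increments, because the process starts at 0 and
  -- monotone paths make truncated differences telescope.
  have hcomp := hind.comp
    (φ := fun x (i : I) => ∑ j ∈ (Finset.range (κ i)).attach,
      x ⟨j, Finset.mem_range.2 ((Finset.mem_range.1 j.2).trans_le (hκn i))⟩)
    (measurable_pi_lambda _ fun i => by fun_prop) hlast
  refine hcomp.congr ?_ ?_
  · filter_upwards [hN.zero, hN.monotone] with ω hz hm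
    funext i
    simp only [Function.comp_apply]
    rw [Finset.sum_attach (Finset.range (κ i)) fun j => N (σ (j + 1)) ω - N (σ j) ω,
      Finset.sum_range_tsub (f := fun j => N (σ j) ω) fun a b hab => hm (hσ hab)]
    simp [σ, h0, hz, hκn, hκ]
  · refine .of_forall fun ω => ?_
    simp [σ, hn]

/-- This is the Poisson generating function. Negative `b` is allowed, as needed for eigenvalues such
as `(-1) ^ k`. -/
theorem integral_pow_increment (hN : IsPoissonProcess N r P) (hr : 0 ≤ r) {s t : ℝ≥0}
    (hst : s ≤ t) (b : ℝ) :
    ∫ ω, b ^ (N t ω - N s ω) ∂P = Real.exp (r * (t - s) * (b - 1)) := by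
  have h := hN.law_increment s t hst
  have hnn : 0 ≤ r * ((t : ℝ) - s) := mul_nonneg hr (sub_nonneg.2 hst)
  rw [← integral_map (φ := fun ω => N t ω - N s ω) (f := fun n : ℕ => b ^ n) h.aemeasurable
    .of_discrete, h.map_eq, integral_poissonMeasure, Real.coe_toNNReal _ hnn]
  have hs := (NormedSpace.expSeries_div_hasSum_exp (𝔸 := ℝ) (r * (t - s) * b)).mul_left
    (Real.exp (-(r * (t - s))))
  rw [← Real.exp_eq_exp_ℝ, ← Real.exp_add] at hs
  rw [show r * ((t : ℝ) - s) * (b - 1) = -(r * (t - s)) + r * (t - s) * b by ring, ← hs.tsum_eq]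
  congr 1
  funext n
  rw [smul_eq_mul, mul_pow (r * ((t : ℝ) - s)) b]
  ring

/-- Conditionally on the past, the increment contributes its probability generating function. -/
theorem integral_past_mul_pow_increment (hN : IsPoissonProcess N r P) (hr : 0 ≤ r) {s t : ℝ≥0}
    (hst : s ≤ t) (I : Finset ℝ≥0) (hI : ∀ i ∈ I, i ≤ s) (h : (I → ℕ) → ℝ) (b : ℝ) :
    ∫ ω, h (fun i => N i ω) * b ^ (N t ω - N s ω) ∂P =
      (∫ ω, h (fun i => N i ω) ∂P) * Real.exp (r * (t - s) * (b - 1)) := by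
  rw [← hN.integral_pow_increment hr hst b]
  exact (hN.indepFun_past_increment hst I hI).integral_fun_comp_mul_comp
    (f := h) (g := fun n : ℕ => b ^ n)
    (measurable_pi_lambda (fun ω (i : I) => N i ω) fun i => hN.measurable i).aemeasurable
    ((hN.measurable t).sub (hN.measurable s)).aemeasurable
    (Measurable.of_discrete).aestronglyMeasurable .of_discrete

end IsPoissonProcess

/-! ### Signs of a telegraph process -/

section Telegraph

variable {Ω : Type*} [MeasurableSpace Ω] {P : Measure Ω}

/-- Markov property of the velocity sign of a telegraph process, tested on monomials. -/
theorem integral_prod_telegraphSign {S : Ω → ℝ} {N : ℝ≥0 → Ω → ℕ} {r : ℝ} (hr : 0 ≤ r)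
    (hS : Measurable S) (hN : IsPoissonProcess N r P)
    (hSN : IndepFun S (fun ω t => N t ω) P) (I : Finset ℝ≥0) (a : ℝ≥0 → ℕ) {s t : ℝ≥0}
    (hI : ∀ i ∈ I, i ≤ s) (hst : s ≤ t) (k : ℕ) :
    ∫ ω, (∏ i ∈ I, (S ω * (-1) ^ N i ω) ^ a i) * (S ω * (-1) ^ N t ω) ^ k ∂P =
      Real.exp (r * (t - s) * ((-1) ^ k - 1)) *
        ∫ ω, (∏ i ∈ I, (S ω * (-1) ^ N i ω) ^ a i) * (S ω * (-1) ^ N s ω) ^ k ∂P := by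
  -- The initial sign is independent of the counts, so its total power is split off. Time `s` joins
  -- the past, and the rest is a function of past counts times `((-1) ^ k)` to the power of the
  -- increment.
  let h : (↥(insert s I) → ℕ) → ℝ := fun x =>
    (∏ i ∈ I.attach, ((-1 : ℝ) ^ x ⟨i, Finset.mem_insert_of_mem i.2⟩) ^ a i) *
      ((-1) ^ x ⟨s, Finset.mem_insert_self s I⟩) ^ k
  have hfac (ω : Ω) : (∏ i ∈ I, (S ω * (-1) ^ N i ω) ^ a i) * (S ω * (-1) ^ N s ω) ^ k =
      S ω ^ ((∑ i ∈ I, a i) + k) * h (fun i => N i ω) := by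
    simp only [h, mul_pow]
    rw [Finset.prod_attach I fun i => ((-1 : ℝ) ^ N i ω) ^ a i, Finset.prod_mul_distrib,
      Finset.prod_pow_eq_pow_sum, pow_add]
    ring
  have hfac' : (fun ω => (∏ i ∈ I, (S ω * (-1) ^ N i ω) ^ a i) * (S ω * (-1) ^ N t ω) ^ k)
      =ᵐ[P] fun ω => S ω ^ ((∑ i ∈ I, a i) + k) *
        (h (fun i => N i ω) * ((-1) ^ k) ^ (N t ω - N s ω)) := by
    filter_upwards [hN.monotone] with ω hm
    rw [← mul_assoc, ← hfac, mul_assoc]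
    congr 1
    obtain ⟨d, hd⟩ := Nat.exists_eq_add_of_le (hm hst)
    rw [show N t ω = N s ω + d from hd, Nat.add_sub_cancel_left, pow_add]
    simp only [mul_pow, ← pow_mul]
    rw [mul_comm k d]
    ring
  have hcoord (i : ℝ≥0) : Measurable fun x : ℝ≥0 → ℕ => x i := measurable_pi_apply i
  have hpath : Measurable fun ω t => N t ω := measurable_pi_lambda _ hN.measurable
  have hh : Measurable fun x : ℝ≥0 → ℕ => h fun i => x i :=
    (Measurable.of_discrete (f := h)).comp (measurable_pi_lambda _ fun i => hcoord i)
  have hb : Measurable fun x : ℝ≥0 → ℕ => ((-1 : ℝ) ^ k) ^ (x t - x s) :=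
    (Measurable.of_discrete (f := fun n : ℕ => ((-1 : ℝ) ^ k) ^ n)).comp
      ((hcoord t).sub (hcoord s))
  have hpow : Measurable fun x : ℝ => x ^ ((∑ i ∈ I, a i) + k) := by fun_prop
  have h1 := hSN.integral_fun_comp_mul_comp hS.aemeasurable hpath.aemeasurable
    hpow.aestronglyMeasurable hh.aestronglyMeasurable
  have h2 := hSN.integral_fun_comp_mul_comp hS.aemeasurable hpath.aemeasurable
    hpow.aestronglyMeasurable (hh.mul hb).aestronglyMeasurable
  have h3 := hN.integral_past_mul_pow_increment hr hst (insert s I)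
    (by simpa using hI) h ((-1) ^ k)
  rw [integral_congr_ae hfac']
  simp only [hfac]
  refine h2.trans ?_
  rw [h1]
  simp only [Pi.mul_apply]
  rw [h3]
  ring

theorem ae_eq_one_or_neg_one [IsProbabilityMeasure P] {S : Ω → ℝ} (hS : Measurable S)
    (h1 : P.real {ω | S ω = 1} = 1 / 2) (h2 : P.real {ω | S ω = -1} = 1 / 2) :
    ∀ᵐ ω ∂P, S ω = 1 ∨ S ω = -1 := by
  have hm1 : MeasurableSet {ω | S ω = 1} := hS (measurableSet_singleton 1)
  have hm2 : MeasurableSet {ω | S ω = -1} := hS (measurableSet_singleton (-1))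
  have hd : Disjoint {ω | S ω = 1} {ω | S ω = -1} := by
    rw [Set.disjoint_left]
    intro ω h h'
    simp only [Set.mem_ofPred_eq] at h h'
    norm_num [h] at h'
  have hu := measureReal_union (μ := P) hd hm2
  rw [h1, h2, add_halves] at hu
  have : P.real ({ω | S ω = 1} ∪ {ω | S ω = -1})ᶜ = 0 := by
    rw [probReal_compl_eq_one_sub (hm1.union hm2), hu, sub_self]
  rw [measureReal_eq_zero_iff] at this
  exact this

theorem integral_pow_of_uniform_sign [IsProbabilityMeasure P] {S : Ω → ℝ} (hS : Measurable S)
    (h1 : P.real {ω | S ω = 1} = 1 / 2) (h2 : P.real {ω | S ω = -1} = 1 / 2) (k : ℕ) :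
    ∫ ω, S ω ^ k ∂P = (1 + (-1) ^ k) / 2 := by
  have hm1 : MeasurableSet {ω | S ω = 1} := hS (measurableSet_singleton 1)
  have hm2 : MeasurableSet {ω | S ω = -1} := hS (measurableSet_singleton (-1))
  have heq : (fun ω => S ω ^ k) =ᵐ[P] fun ω => {ω | S ω = 1}.indicator (fun _ => (1 : ℝ)) ω +
      {ω | S ω = -1}.indicator (fun _ => (-1 : ℝ) ^ k) ω := by
    filter_upwards [ae_eq_one_or_neg_one hS h1 h2] with ω hω
    rcases hω with h | h <;> simp [Set.indicator, h] <;> norm_num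
  rw [integral_congr_ae heq, integral_add ((integrable_const _).indicator hm1)
    ((integrable_const _).indicator hm2), integral_indicator_const _ hm1,
    integral_indicator_const _ hm2, h1, h2]
  simp only [smul_eq_mul]
  ring

end Telegraph

/-! ### Directions as pairs of signs -/

/-- The velocity along the first diagonal, up to a factor, in the direction `d_j`. -/
def uSign (j : ZMod 4) : ℝ := if j = 0 ∨ j = 1 then 1 else -1

/-- The velocity along the second diagonal, up to a factor, in the direction `d_j`. -/
def vSign (j : ZMod 4) : ℝ := if j = 0 ∨ j = 3 then 1 else -1

theorem uSign_eq (j : ZMod 4) : uSign j = 1 ∨ uSign j = -1 := by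
  unfold uSign; split_ifs <;> simp

theorem vSign_eq (j : ZMod 4) : vSign j = 1 ∨ vSign j = -1 := by
  unfold vSign; split_ifs <;> simp

/-- The sums and differences of the coordinates of `d_j` are ±1; solving for the coordinates
produces the factor 1/2 in the telegraph velocity. -/
theorem cos_direction (j : ZMod 4) :
    Real.cos (Real.pi * (j.val : ℝ) / 2) = (uSign j + vSign j) / 2 := by
  have h3 : Real.cos (Real.pi * 3 / 2) = 0 := by
    rw [show Real.pi * 3 / 2 = Real.pi / 2 + Real.pi by ring, Real.cos_add_pi]; simp
  have e2 : (2 : ZMod 4).val = 2 := rfl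
  have e3 : (3 : ZMod 4).val = 3 := rfl
  have e1 : (1 : ZMod 4).val = 1 := rfl
  have e0 : (0 : ZMod 4).val = 0 := rfl
  have : j = 0 ∨ j = 1 ∨ j = 2 ∨ j = 3 := by revert j; decide
  rcases this with rfl | rfl | rfl | rfl
  · simp [uSign, vSign]
  · simp [uSign, vSign, e1, show (1 : ZMod 4) ≠ 3 by decide, show (1 : ZMod 4) ≠ 0 by decide]
  · simp [uSign, vSign, e2, show (2 : ZMod 4) ≠ 3 by decide, show (2 : ZMod 4) ≠ 0 by decide,
      show (2 : ZMod 4) ≠ 1 by decide]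
  · simp [uSign, vSign, e3, show (3 : ZMod 4) ≠ 1 by decide, show (3 : ZMod 4) ≠ 0 by decide, h3]

theorem sin_direction (j : ZMod 4) :
    Real.sin (Real.pi * (j.val : ℝ) / 2) = (uSign j - vSign j) / 2 := by
  have h3 : Real.sin (Real.pi * 3 / 2) = -1 := by
    rw [show Real.pi * 3 / 2 = Real.pi / 2 + Real.pi by ring, Real.sin_add_pi]; simp
  have e2 : (2 : ZMod 4).val = 2 := rfl
  have e3 : (3 : ZMod 4).val = 3 := rfl
  have e1 : (1 : ZMod 4).val = 1 := rfl
  have e0 : (0 : ZMod 4).val = 0 := rfl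
  have : j = 0 ∨ j = 1 ∨ j = 2 ∨ j = 3 := by revert j; decide
  rcases this with rfl | rfl | rfl | rfl
  · simp [uSign, vSign]
  · simp [uSign, vSign, e1, show (1 : ZMod 4) ≠ 3 by decide, show (1 : ZMod 4) ≠ 0 by decide]
  · simp [uSign, vSign, e2, show (2 : ZMod 4) ≠ 3 by decide, show (2 : ZMod 4) ≠ 0 by decide,
      show (2 : ZMod 4) ≠ 1 by decide]
  · simp [uSign, vSign, e3, show (3 : ZMod 4) ≠ 1 by decide, show (3 : ZMod 4) ≠ 0 by decide, h3]
    norm_num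

/-- The monomials in the two signs are eigenfunctions of the transition matrix. -/
theorem sum_turnProb_mul (p : ℝ) (i : ZMod 4) (k l : ℕ) :
    ∑ j, turnProb p i j * (uSign j ^ k * vSign j ^ l) =
      ((1 - p) * (-1) ^ k + p * (-1) ^ l) * (uSign i ^ k * vSign i ^ l) := by
  have hsum (f : ZMod 4 → ℝ) : ∑ j, f j = f 0 + f 1 + f 2 + f 3 := Fin.sum_univ_four f
  have hk : ((-1 : ℝ) ^ k) * (-1) ^ k = 1 := by rw [← mul_pow]; simp
  have hl : ((-1 : ℝ) ^ l) * (-1) ^ l = 1 := by rw [← mul_pow]; simp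
  have t (p : ℝ) (i j : ZMod 4) : turnProb p i j = if j = i + 1 then
    (if i = 0 ∨ i = 2 then p else 1 - p) else if j = i - 1 then
    (if i = 0 ∨ i = 2 then 1 - p else p) else 0 := rfl
  have : i = 0 ∨ i = 1 ∨ i = 2 ∨ i = 3 := by revert i; decide
  rw [hsum]
  -- In all four cases the neighbour reached with probability `1 - p` differs only in `uSign`, and
  -- the one reached with probability `p` only in `vSign`.
  rcases this with rfl | rfl | rfl | rfl
  · simp +decide [uSign, vSign, t]
    ring
  · simp +decide [uSign, vSign, t]
    linear_combination -p * hl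
  · simp +decide [uSign, vSign, t]
    linear_combination (-(1 - p) * (-1) ^ l) * hk - p * (-1) ^ k * hl
  · simp +decide [uSign, vSign, t]
    linear_combination (-(1 - p)) * hk

theorem integral_comp_eq_sum_real {Ω ι : Type*} [MeasurableSpace Ω] {P : Measure Ω}
    [IsProbabilityMeasure P] [Fintype ι] [MeasurableSpace ι] [MeasurableSingletonClass ι]
    {Z : Ω → ι} (hZ : Measurable Z) (g : ι → ℝ) :
    ∫ ω, g (Z ω) ∂P = ∑ z, P.real {ω | Z ω = z} * g z := by
  have := Measure.isProbabilityMeasure_map (μ := P) hZ.aemeasurable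
  rw [← integral_map hZ.aemeasurable (f := g) (Measurable.of_discrete).aestronglyMeasurable,
    integral_fintype .of_finite]
  refine Finset.sum_congr rfl fun z _ => ?_
  rw [map_measureReal_apply hZ (measurableSet_singleton z), smul_eq_mul]
  rfl

/-- Fubini for the product law: `Y` can be frozen while `X` is averaged. It is applied with `X` the
direction chain and `Y` the counting path. -/
theorem integral_indepFun_eq_integral_integral {Ω α β : Type*} [MeasurableSpace Ω]
    [MeasurableSpace α] [MeasurableSpace β] {P : Measure Ω} [IsProbabilityMeasure P]
    {X : Ω → α} {Y : Ω → β} (hX : Measurable X) (hY : Measurable Y) (h : IndepFun X Y P)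
    {G : α × β → ℝ} (hG : Measurable G) {C : ℝ} (hC : ∀ z, |G z| ≤ C) :
    ∫ ω, G (X ω, Y ω) ∂P = ∫ ω', ∫ ω, G (X ω, Y ω') ∂P ∂P := by
  have := Measure.isProbabilityMeasure_map (μ := P) hX.aemeasurable
  have := Measure.isProbabilityMeasure_map (μ := P) hY.aemeasurable
  rw [← integral_map (φ := fun ω => (X ω, Y ω)) (hX.prodMk hY).aemeasurable
    hG.aestronglyMeasurable,
    (indepFun_iff_map_prod_eq_prod_map_map hX.aemeasurable hY.aemeasurable).1 h,
    integral_prod_symm G (.of_bound hG.aestronglyMeasurable C (.of_forall hC)),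
    integral_map hY.aemeasurable
      (hG.stronglyMeasurable.integral_prod_left' (μ := P.map X)).aestronglyMeasurable]
  refine integral_congr_ae (.of_forall fun ω' => ?_)
  exact integral_map hX.aemeasurable (hG.comp (measurable_id.prodMk
    measurable_const)).aestronglyMeasurable

/-! ### Moments of the direction chain -/

namespace IsDirectionChain

variable {Ω : Type*} [MeasurableSpace Ω] {P : Measure Ω} [IsProbabilityMeasure P]
  {E : ℕ → Ω → ZMod 4} {p : ℝ}

theorem integral_past_mul_succ (hE : IsDirectionChain E p P) (n : ℕ)
    (F : (Fin (n + 1) → ZMod 4) → ℝ) (k l : ℕ) :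
    ∫ ω, F (fun i => E i ω) * (uSign (E (n + 1) ω) ^ k * vSign (E (n + 1) ω) ^ l) ∂P =
      ((1 - p) * (-1) ^ k + p * (-1) ^ l) *
        ∫ ω, F (fun i => E i ω) * (uSign (E n ω) ^ k * vSign (E n ω) ^ l) ∂P := by
  have hW : Measurable fun ω (i : Fin (n + 1)) => E i ω :=
    measurable_pi_lambda _ fun i => hE.measurable i
  have hprob (w : Fin (n + 1) → ZMod 4) (j : ZMod 4) :
      P.real {ω | ((fun i : Fin (n + 1) => E i ω), E (n + 1) ω) = (w, j)} =
        P.real {ω | (fun i : Fin (n + 1) => E i ω) = w} * turnProb p (w (Fin.last n)) j := by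
    -- The word `w` is continued by `j`; letters after index `n + 1` play no role.
    have := hE.transition n fun i => if h : i < n + 1 then w ⟨i, h⟩ else j
    convert this using 2
    · congr 1
      ext ω
      simp only [Prod.mk.injEq, funext_iff]
      constructor
      · rintro ⟨h1, h2⟩ i hi
        by_cases hin : i < n + 1
        · simpa [hin] using h1 ⟨i, hin⟩
        · obtain rfl : i = n + 1 := by omega
          simpa using h2
      · intro h
        exact ⟨fun i => by simpa [i.2] using h i (by omega), by simpa using h (n + 1) le_rfl⟩
    · congr 1
      ext ω
      simp only [funext_iff, Set.mem_ofPred_eq]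
      constructor
      · intro h1 i hi
        have hin : i < n + 1 := by omega
        simpa [hin] using h1 ⟨i, hin⟩
      · intro h i
        simpa [i.2] using h i (by omega)
    · simp [Fin.last]
  have hlast := integral_comp_eq_sum_real (P := P) hW fun w => F w *
    (uSign (w (Fin.last n)) ^ k * vSign (w (Fin.last n)) ^ l)
  simp only [Fin.val_last] at hlast
  rw [integral_comp_eq_sum_real (hW.prodMk (hE.measurable (n + 1)))
    fun z => F z.1 * (uSign z.2 ^ k * vSign z.2 ^ l),
    hlast, Fintype.sum_prod_type, Finset.mul_sum]
  refine Finset.sum_congr rfl fun w _ => ?_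
  rw [show ∀ x y z q : ℝ, q * (x * (y * z)) = x * y * (q * z) from fun x y z q => by ring,
    ← sum_turnProb_mul, Finset.mul_sum]
  refine Finset.sum_congr rfl fun j _ => ?_
  rw [hprob]
  ring

/-- Each of the last `d` steps contributes one factor of the eigenvalue, since the product over `I`
involves only indices up to `q`. -/
theorem integral_prod_mul_add (hE : IsDirectionChain E p P) (I : Finset ℝ≥0) (a b : ℝ≥0 → ℕ)
    (n : ℝ≥0 → ℕ) {q : ℕ} (hn : ∀ i ∈ I, n i ≤ q) (d k l : ℕ) :
    ∫ ω, (∏ i ∈ I, uSign (E (n i) ω) ^ a i * vSign (E (n i) ω) ^ b i) *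
        (uSign (E (q + d) ω) ^ k * vSign (E (q + d) ω) ^ l) ∂P =
      ((1 - p) * (-1) ^ k + p * (-1) ^ l) ^ d *
        ∫ ω, (∏ i ∈ I, uSign (E (n i) ω) ^ a i * vSign (E (n i) ω) ^ b i) *
          (uSign (E q ω) ^ k * vSign (E q ω) ^ l) ∂P := by
  induction d with
  | zero => simp
  | succ d ih =>
    have := hE.integral_past_mul_succ (q + d) (fun w => ∏ i ∈ I.attach,
      uSign (w ⟨n i, (hn i i.2).trans_lt (by omega)⟩) ^ a i *
        vSign (w ⟨n i, (hn i i.2).trans_lt (by omega)⟩) ^ b i) k l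
    have hatt (ω : Ω) := Finset.prod_attach I fun i =>
      uSign (E (n i) ω) ^ a i * vSign (E (n i) ω) ^ b i
    simp only [hatt] at this
    rw [← add_assoc, this, ih]
    ring

end IsDirectionChain

/-! ### The common moment recursion -/

/-- The mixed moments of a pair of sign processes that are flipped independently at constant
rates `r₁` and `r₂`, starting from uniform signs. -/
structure HasFlipMoments {Ω : Type*} [MeasurableSpace Ω] (u v : ℝ≥0 → Ω → ℝ) (r₁ r₂ : ℝ)
    (P : Measure Ω) : Prop where
  initial : ∀ k l : ℕ, ∫ ω, u 0 ω ^ k * v 0 ω ^ l ∂P = (1 + (-1) ^ k) / 2 * ((1 + (-1) ^ l) / 2)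
  markov : ∀ (I : Finset ℝ≥0) (a b : ℝ≥0 → ℕ) (s t : ℝ≥0), (∀ i ∈ I, i ≤ s) → s ≤ t →
    ∀ k l : ℕ, ∫ ω, (∏ i ∈ I, u i ω ^ a i * v i ω ^ b i) * (u t ω ^ k * v t ω ^ l) ∂P =
      Real.exp ((t - s) * (r₁ * ((-1) ^ k - 1) + r₂ * ((-1) ^ l - 1))) *
        ∫ ω, (∏ i ∈ I, u i ω ^ a i * v i ω ^ b i) * (u s ω ^ k * v s ω ^ l) ∂P

theorem abs_monomial_le_one {x y : ℝ} (hx : x = 1 ∨ x = -1) (hy : y = 1 ∨ y = -1) (k l : ℕ) :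
    |x ^ k * y ^ l| ≤ 1 := by
  have hx' : |x| = 1 := by rcases hx with rfl | rfl <;> simp
  have hy' : |y| = 1 := by rcases hy with rfl | rfl <;> simp
  simp [abs_mul, abs_pow, hx', hy']

theorem measurable_eval_nat {α : Type*} [MeasurableSpace α] :
    Measurable fun z : (ℕ → α) × ℕ => z.1 z.2 :=
  measurable_from_prod_countable_left fun n => measurable_pi_apply n

theorem hasFlipMoments_planarMotion {Ω : Type*} [MeasurableSpace Ω] {P : Measure Ω}
    [IsProbabilityMeasure P] {E : ℕ → Ω → ZMod 4} {N : ℝ≥0 → Ω → ℕ} {r p : ℝ} (hr : 0 ≤ r)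
    (hE : IsDirectionChain E p P) (hN : IsPoissonProcess N r P)
    (hEN : IndepFun (fun ω n => E n ω) (fun ω t => N t ω) P) :
    HasFlipMoments (fun t ω => uSign (E (N t ω) ω)) (fun t ω => vSign (E (N t ω) ω))
      (r * (1 - p)) (r * p) P where
  initial k l := by
    have h0 : (fun ω => uSign (E (N 0 ω) ω) ^ k * vSign (E (N 0 ω) ω) ^ l) =ᵐ[P]
        fun ω => uSign (E 0 ω) ^ k * vSign (E 0 ω) ^ l := by
      filter_upwards [hN.zero] with ω hω
      rw [hω]
    rw [integral_congr_ae h0, integral_comp_eq_sum_real (hE.measurable 0)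
      fun j => uSign j ^ k * vSign j ^ l]
    simp only [hE.initial]
    have hsum (f : ZMod 4 → ℝ) : ∑ j, f j = f 0 + f 1 + f 2 + f 3 := Fin.sum_univ_four f
    rw [hsum]
    simp +decide [uSign, vSign]
    ring
  markov I a b s t hI hst k l := by
    let G (t : ℝ≥0) : (ℕ → ZMod 4) × (ℝ≥0 → ℕ) → ℝ := fun z =>
      (∏ i ∈ I, uSign (z.1 (z.2 i)) ^ a i * vSign (z.1 (z.2 i)) ^ b i) *
        (uSign (z.1 (z.2 t)) ^ k * vSign (z.1 (z.2 t)) ^ l)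
    have hG (t : ℝ≥0) : Measurable (G t) := by
      have hev (i : ℝ≥0) : Measurable fun z : (ℕ → ZMod 4) × (ℝ≥0 → ℕ) => z.1 (z.2 i) :=
        measurable_eval_nat.comp
          (measurable_fst.prodMk ((measurable_pi_apply i).comp measurable_snd))
      have hmono (i : ℝ≥0) (k l : ℕ) : Measurable fun z : (ℕ → ZMod 4) × (ℝ≥0 → ℕ) =>
          uSign (z.1 (z.2 i)) ^ k * vSign (z.1 (z.2 i)) ^ l :=
        (Measurable.of_discrete (f := fun j => uSign j ^ k * vSign j ^ l)).comp (hev i)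
      exact (Finset.measurable_prod _ fun i _ => hmono i _ _).mul (hmono t _ _)
    have hGC (t : ℝ≥0) (z) : |G t z| ≤ 1 := by
      rw [abs_mul, Finset.abs_prod]
      exact mul_le_one₀ (Finset.prod_le_one (fun _ _ => abs_nonneg _) fun i _ =>
        abs_monomial_le_one (uSign_eq _) (vSign_eq _) _ _) (abs_nonneg _)
        (abs_monomial_le_one (uSign_eq _) (vSign_eq _) _ _)
    have hEm : Measurable fun ω n => E n ω := measurable_pi_lambda _ hE.measurable
    have hNm : Measurable fun ω t => N t ω := measurable_pi_lambda _ hN.measurable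
    -- Averaging over the chain with the counts frozen leaves a function of the counts at `s` and at
    -- times in `I` only, hence independent of the increment after `s`.
    let H : (↥(insert s I) → ℕ) → ℝ := fun x => ∫ ω,
      (∏ i ∈ I.attach, uSign (E (x ⟨i, Finset.mem_insert_of_mem i.2⟩) ω) ^ a i *
        vSign (E (x ⟨i, Finset.mem_insert_of_mem i.2⟩) ω) ^ b i) *
        (uSign (E (x ⟨s, Finset.mem_insert_self s I⟩) ω) ^ k *
          vSign (E (x ⟨s, Finset.mem_insert_self s I⟩) ω) ^ l) ∂P
    have hH (ω' : Ω) : H (fun i => N i ω') = ∫ ω, G s (fun n => E n ω, fun t => N t ω') ∂P := by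
      simp only [H, G]
      refine integral_congr_ae (.of_forall fun ω => ?_)
      simp only
      rw [Finset.prod_attach I fun i => uSign (E (N i ω') ω) ^ a i * vSign (E (N i ω') ω) ^ b i]
    have hinner : (fun ω' => ∫ ω, G t (fun n => E n ω, fun t => N t ω') ∂P) =ᵐ[P]
        fun ω' => H (fun i => N i ω') *
          ((1 - p) * (-1) ^ k + p * (-1) ^ l) ^ (N t ω' - N s ω') := by
      filter_upwards [hN.monotone] with ω' hm
      have := hE.integral_prod_mul_add I a b (fun i => N i ω') (q := N s ω')
        (fun i hi => hm (hI i hi)) (N t ω' - N s ω') k l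
      rw [Nat.add_sub_cancel' (hm hst)] at this
      rw [hH, mul_comm]
      exact this
    have e1 := integral_indepFun_eq_integral_integral hEm hNm hEN (hG t) (hGC t)
    have e2 := integral_indepFun_eq_integral_integral hEm hNm hEN (hG s) (hGC s)
    refine e1.trans ?_
    rw [integral_congr_ae hinner,
      hN.integral_past_mul_pow_increment hr hst (insert s I) (by simpa using hI) H, mul_comm]
    congr 1
    -- Since (1 - p) + p = 1, the eigenvalue minus 1 is (1-p)((-1)^k - 1) + p((-1)^l - 1).
    · congr 1; ring
    · simp only [hH]; exact e2.symm

theorem hasFlipMoments_prod_telegraph {Ω : Type*} [MeasurableSpace Ω] {P : Measure Ω}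
    [IsProbabilityMeasure P] {S T : Ω → ℝ} {M N : ℝ≥0 → Ω → ℕ} {r₁ r₂ : ℝ} (hr₁ : 0 ≤ r₁)
    (hr₂ : 0 ≤ r₂) (hS : Measurable S) (hS1 : P.real {ω | S ω = 1} = 1 / 2)
    (hS2 : P.real {ω | S ω = -1} = 1 / 2) (hT : Measurable T)
    (hT1 : P.real {ω | T ω = 1} = 1 / 2) (hT2 : P.real {ω | T ω = -1} = 1 / 2)
    (hM : IsPoissonProcess M r₁ P) (hN : IsPoissonProcess N r₂ P)
    (hSM : IndepFun S (fun ω t => M t ω) P) (hTN : IndepFun T (fun ω t => N t ω) P) :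
    HasFlipMoments (fun t (ω : Ω × Ω) => S ω.1 * (-1) ^ M t ω.1)
      (fun t ω => T ω.2 * (-1) ^ N t ω.2) r₁ r₂ (P.prod P) where
  initial k l := by
    have h1 : (fun ω => (S ω * (-1) ^ M 0 ω) ^ k) =ᵐ[P] fun ω => S ω ^ k := by
      filter_upwards [hM.zero] with ω h
      simp [h]
    have h2 : (fun ω => (T ω * (-1) ^ N 0 ω) ^ l) =ᵐ[P] fun ω => T ω ^ l := by
      filter_upwards [hN.zero] with ω h
      simp [h]
    rw [integral_prod_mul (fun ω => (S ω * (-1) ^ M 0 ω) ^ k) fun ω => (T ω * (-1) ^ N 0 ω) ^ l,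
      integral_congr_ae h1, integral_congr_ae h2, integral_pow_of_uniform_sign hS hS1 hS2,
      integral_pow_of_uniform_sign hT hT1 hT2]
  markov I a b s t hI hst k l := by
    have hsplit (t : ℝ≥0) :
        ∫ ω : Ω × Ω, (∏ i ∈ I, (S ω.1 * (-1) ^ M i ω.1) ^ a i * (T ω.2 * (-1) ^ N i ω.2) ^ b i) *
          ((S ω.1 * (-1) ^ M t ω.1) ^ k * (T ω.2 * (-1) ^ N t ω.2) ^ l) ∂P.prod P =
        (∫ ω, (∏ i ∈ I, (S ω * (-1) ^ M i ω) ^ a i) * (S ω * (-1) ^ M t ω) ^ k ∂P) *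
          ∫ ω, (∏ i ∈ I, (T ω * (-1) ^ N i ω) ^ b i) * (T ω * (-1) ^ N t ω) ^ l ∂P := by
      rw [← integral_prod_mul]
      refine integral_congr_ae (.of_forall fun ω => ?_)
      simp only [Finset.prod_mul_distrib]
      ring
    rw [hsplit, hsplit, integral_prod_telegraphSign hr₁ hS hM hSM I a hI hst,
      integral_prod_telegraphSign hr₂ hT hN hTN I b hI hst, mul_add, Real.exp_add]
    rw [show (t - s : ℝ) * (r₁ * ((-1) ^ k - 1)) = r₁ * (t - s) * ((-1) ^ k - 1) by ring,
      show (t - s : ℝ) * (r₂ * ((-1) ^ l - 1)) = r₂ * (t - s) * ((-1) ^ l - 1) by ring]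
    ring

namespace HasFlipMoments

variable {Ω Ω' : Type*} [MeasurableSpace Ω] [MeasurableSpace Ω'] {P : Measure Ω}
  {P' : Measure Ω'} {u v : ℝ≥0 → Ω → ℝ} {u' v' : ℝ≥0 → Ω' → ℝ} {r₁ r₂ : ℝ}

/-- The Markov relation moves the factors at the largest time back to the previous one, where they
merge by adding exponents. Induction removes the times one by one, down to the uniform signs at time
0. -/
theorem integral_prod_eq [IsProbabilityMeasure P] [IsProbabilityMeasure P']
    (h : HasFlipMoments u v r₁ r₂ P) (h' : HasFlipMoments u' v' r₁ r₂ P')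
    (I : Finset ℝ≥0) : ∀ a b : ℝ≥0 → ℕ,
    ∫ ω, ∏ i ∈ I, u i ω ^ a i * v i ω ^ b i ∂P = ∫ ω, ∏ i ∈ I, u' i ω ^ a i * v' i ω ^ b i ∂P' := by
  induction I using Finset.induction_on_max with
  | empty => simp
  | insert t I ht ih =>
    intro a b
    have hnot : t ∉ I := fun hmem => (ht t hmem).false
    simp only [Finset.prod_insert hnot]
    simp only [mul_comm (u t _ ^ a t * _), mul_comm (u' t _ ^ a t * _)]
    rcases I.eq_empty_or_nonempty with rfl | hne
    · have e1 := h.markov ∅ a b 0 t (by simp) (zero_le) (a t) (b t)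
      have e2 := h'.markov ∅ a b 0 t (by simp) (zero_le) (a t) (b t)
      rw [e1, e2]
      simp only [Finset.prod_empty, one_mul, h.initial, h'.initial]
    · set s := I.max' hne with hs
      have hsI : s ∈ I := I.max'_mem hne
      rw [h.markov I a b s t (fun i hi => I.le_max' i hi) (ht s hsI).le,
        h'.markov I a b s t (fun i hi => I.le_max' i hi) (ht s hsI).le]
      congr 1
      have merge (x y : ℝ≥0 → ℝ) :
          (∏ i ∈ I, x i ^ a i * y i ^ b i) * (x s ^ a t * y s ^ b t) =
          ∏ i ∈ I, x i ^ (a i + if i = s then a t else 0) *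
            y i ^ (b i + if i = s then b t else 0) := by
        have hfac : x s ^ a t * y s ^ b t = ∏ i ∈ I,
            x i ^ (if i = s then a t else 0) * y i ^ (if i = s then b t else 0) := by
          rw [Finset.prod_eq_single_of_mem s hsI fun i _ hi => by simp [hi]]
          simp
        rw [hfac, ← Finset.prod_mul_distrib]
        exact Finset.prod_congr rfl fun i _ => by rw [pow_add, pow_add]; ring
      simp only [fun ω => merge (fun i => u i ω) fun i => v i ω,
        fun ω => merge (fun i => u' i ω) fun i => v' i ω]
      exact ih _ _

end HasFlipMoments

/-! ### From mixed moments to the law on path space -/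

/-- The coefficients of `exp (i α x)` as an affine function of the sign `x`. -/
noncomputable def signExpCoeff (α : ℝ) (e : Fin 2) : ℂ :=
  if e = 0 then (Real.cos α : ℂ) else (Real.sin α : ℂ) * Complex.I

/-- For x = ±1, evenness of cosine and oddness of sine turn Euler's formula into cos α + i x sin α.
-/
theorem exp_mul_sign {x : ℝ} (hx : x = 1 ∨ x = -1) (α : ℝ) :
    Complex.exp ((α * x : ℝ) * Complex.I) = ∑ e : Fin 2, signExpCoeff α e * (x : ℂ) ^ (e : ℕ) := by
  rw [Fin.sum_univ_two, Complex.exp_mul_I]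
  rcases hx with rfl | rfl <;> simp [signExpCoeff]

theorem exp_sum_signs {ι : Type*} [Fintype ι] [DecidableEq ι] {x y : ι → ℝ}
    (hx : ∀ i, x i = 1 ∨ x i = -1) (hy : ∀ i, y i = 1 ∨ y i = -1) (α β : ι → ℝ) :
    Complex.exp ((∑ i, (α i * x i + β i * y i) : ℝ) * Complex.I) =
      ∑ q : ι → Fin 2 × Fin 2, (∏ i, signExpCoeff (α i) (q i).1 * signExpCoeff (β i) (q i).2) *
        ((∏ i, x i ^ ((q i).1 : ℕ) * y i ^ ((q i).2 : ℕ) : ℝ) : ℂ) := by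
  have h1 (i : ι) : Complex.exp ((α i * x i + β i * y i : ℝ) * Complex.I) =
      ∑ q : Fin 2 × Fin 2, signExpCoeff (α i) q.1 * signExpCoeff (β i) q.2 *
        ((x i ^ (q.1 : ℕ) * y i ^ (q.2 : ℕ) : ℝ) : ℂ) := by
    rw [Complex.ofReal_add, add_mul, Complex.exp_add, exp_mul_sign (hx i), exp_mul_sign (hy i),
      Finset.sum_mul_sum, Fintype.sum_prod_type]
    refine Finset.sum_congr rfl fun e _ => Finset.sum_congr rfl fun f _ => ?_
    push_cast
    ring
  rw [Complex.ofReal_sum, Finset.sum_mul, Complex.exp_sum, Finset.prod_congr rfl fun i _ => h1 i,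
    Finset.prod_univ_sum, Fintype.piFinset_univ]
  refine Finset.sum_congr rfl fun q _ => ?_
  rw [Finset.prod_mul_distrib, Complex.ofReal_prod]

section Law

variable {Ω : Type*} [MeasurableSpace Ω] {P : Measure Ω} [IsProbabilityMeasure P]
  {u v : ℝ≥0 → Ω → ℝ}

theorem abs_prod_monomial_le_one {ι : Type*} [Fintype ι] {x y : ι → ℝ}
    (hx : ∀ i, x i = 1 ∨ x i = -1) (hy : ∀ i, y i = 1 ∨ y i = -1) (a b : ι → ℕ) :
    |∏ i, x i ^ a i * y i ^ b i| ≤ 1 := by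
  rw [Finset.abs_prod]
  exact Finset.prod_le_one (fun _ _ => abs_nonneg _) fun i _ =>
    abs_monomial_le_one (hx i) (hy i) _ _

/-- Since the exponential is affine in each sign, the characteristic function is a finite
combination of mixed moments with exponents 0 and 1. -/
theorem charFunDual_signs (hu : ∀ t, Measurable (u t)) (hv : ∀ t, Measurable (v t))
    (hu1 : ∀ᵐ ω ∂P, ∀ t, u t ω = 1 ∨ u t ω = -1) (hv1 : ∀ᵐ ω ∂P, ∀ t, v t ω = 1 ∨ v t ω = -1)
    (I : Finset ℝ≥0) (L : StrongDual ℝ (I → ℝ × ℝ)) :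
    charFunDual (P.map fun ω (i : I) => (u i ω, v i ω)) L =
      ∑ q : I → Fin 2 × Fin 2, (∏ i, signExpCoeff (L (Pi.single i (1, 0))) (q i).1 *
        signExpCoeff (L (Pi.single i (0, 1))) (q i).2) *
        ((∫ ω, ∏ i : I, u i ω ^ ((q i).1 : ℕ) * v i ω ^ ((q i).2 : ℕ) ∂P : ℝ) : ℂ) := by
  have hL (x : I → ℝ × ℝ) : L x = ∑ i, (L (Pi.single i (1, 0)) * (x i).1 +
      L (Pi.single i (0, 1)) * (x i).2) := by
    conv_lhs => rw [← Finset.univ_sum_single x, map_sum]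
    refine Finset.sum_congr rfl fun i _ => ?_
    have : (Pi.single i (x i) : I → ℝ × ℝ) = (x i).1 • (Pi.single i (1, 0) : I → ℝ × ℝ) +
        (x i).2 • (Pi.single i (0, 1) : I → ℝ × ℝ) := by
      rw [← Pi.single_smul, ← Pi.single_smul, ← Pi.single_add]
      simp
    rw [this, map_add, map_smul, map_smul, smul_eq_mul, smul_eq_mul]
    ring
  have hmeas : Measurable fun ω (i : I) => (u i ω, v i ω) :=
    measurable_pi_lambda _ fun i => (hu i).prodMk (hv i)
  rw [charFunDual_apply, integral_map hmeas.aemeasurable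
    (Continuous.aestronglyMeasurable (by fun_prop))]
  have hexp : (fun ω => Complex.exp ((L fun i : I => (u i ω, v i ω)) * Complex.I)) =ᵐ[P] fun ω =>
      ∑ q : I → Fin 2 × Fin 2, (∏ i, signExpCoeff (L (Pi.single i (1, 0))) (q i).1 *
        signExpCoeff (L (Pi.single i (0, 1))) (q i).2) *
        ((∏ i : I, u i ω ^ ((q i).1 : ℕ) * v i ω ^ ((q i).2 : ℕ) : ℝ) : ℂ) := by
    filter_upwards [hu1, hv1] with ω h1 h2
    rw [hL, ← exp_sum_signs (fun i : I => h1 i) fun i : I => h2 i]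
  rw [integral_congr_ae hexp, integral_finsetSum]
  · refine Finset.sum_congr rfl fun q _ => ?_
    rw [integral_const_mul, integral_complex_ofReal]
  · intro q _
    refine Integrable.const_mul (Integrable.ofReal ?_) _
    refine .of_bound (C := 1) (Measurable.aestronglyMeasurable ?_) ?_
    · exact Finset.measurable_prod _ fun i _ => ((hu i).pow_const _).mul ((hv i).pow_const _)
    · filter_upwards [hu1, hv1] with ω h1 h2
      exact abs_prod_monomial_le_one (fun i : I => h1 i) (fun i : I => h2 i) _ _

variable {Ω' : Type*} [MeasurableSpace Ω'] {P' : Measure Ω'} [IsProbabilityMeasure P']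
  {u' v' : ℝ≥0 → Ω' → ℝ} {r₁ r₂ : ℝ}

/-- The flip moments determine the law of a pair of sign processes. -/
theorem HasFlipMoments.identDistrib (h : HasFlipMoments u v r₁ r₂ P)
    (h' : HasFlipMoments u' v' r₁ r₂ P')
    (hu : ∀ t, Measurable (u t)) (hv : ∀ t, Measurable (v t))
    (hu1 : ∀ᵐ ω ∂P, ∀ t, u t ω = 1 ∨ u t ω = -1) (hv1 : ∀ᵐ ω ∂P, ∀ t, v t ω = 1 ∨ v t ω = -1)
    (hu' : ∀ t, Measurable (u' t)) (hv' : ∀ t, Measurable (v' t))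
    (hu1' : ∀ᵐ ω ∂P', ∀ t, u' t ω = 1 ∨ u' t ω = -1)
    (hv1' : ∀ᵐ ω ∂P', ∀ t, v' t ω = 1 ∨ v' t ω = -1) :
    IdentDistrib (fun ω t => (u t ω, v t ω)) (fun ω t => (u' t ω, v' t ω)) P P' := by
  have hm : Measurable fun ω t => (u t ω, v t ω) :=
    measurable_pi_lambda _ fun t => (hu t).prodMk (hv t)
  have hm' : Measurable fun ω t => (u' t ω, v' t ω) :=
    measurable_pi_lambda _ fun t => (hu' t).prodMk (hv' t)
  refine ⟨hm.aemeasurable, hm'.aemeasurable, ?_⟩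
  have hfdd (I : Finset ℝ≥0) : P.map (fun ω => I.restrict fun t => (u t ω, v t ω)) =
      P'.map (fun ω => I.restrict fun t => (u' t ω, v' t ω)) := by
    have := Measure.isProbabilityMeasure_map (μ := P)
      ((Finset.measurable_restrict I).comp hm).aemeasurable
    have := Measure.isProbabilityMeasure_map (μ := P')
      ((Finset.measurable_restrict I).comp hm').aemeasurable
    refine Measure.ext_of_charFunDual (funext fun L => ?_)
    refine (charFunDual_signs hu hv hu1 hv1 I L).trans
      (Eq.trans ?_ (charFunDual_signs hu' hv' hu1' hv1' I L).symm)
    refine Finset.sum_congr rfl fun q _ => ?_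
    congr 2
    have key := h.integral_prod_eq h' I (fun t => if ht : t ∈ I then ((q ⟨t, ht⟩).1 : ℕ) else 0)
      fun t => if ht : t ∈ I then ((q ⟨t, ht⟩).2 : ℕ) else 0
    have hatt (x y : ℝ≥0 → ℝ) : ∏ t ∈ I, x t ^ (if ht : t ∈ I then ((q ⟨t, ht⟩).1 : ℕ) else 0) *
        y t ^ (if ht : t ∈ I then ((q ⟨t, ht⟩).2 : ℕ) else 0) =
        ∏ i : I, x i ^ ((q i).1 : ℕ) * y i ^ ((q i).2 : ℕ) := by
      rw [← Finset.prod_coe_sort]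
      exact Finset.prod_congr rfl fun i _ => by simp
    simpa only [fun ω => hatt (fun t => u t ω) fun t => v t ω,
      fun ω => hatt (fun t => u' t ω) fun t => v' t ω] using key
  have := Measure.isProbabilityMeasure_map (μ := P) hm.aemeasurable
  -- A finite measure on path space is determined by its finite-dimensional marginals.
  refine (isProjectiveLimit_map hm.aemeasurable).unique
    (P := fun I => P.map fun ω => I.restrict fun t => (u t ω, v t ω)) ?_
  simp only [hfdd]
  exact isProjectiveLimit_map hm'.aemeasurable

end Law

/-! ### Positions as functionals of the signs -/

theorem intervalIntegrable_comp_monotone {n : ℝ≥0 → ℕ} (hn : Monotone n) {g : ℕ → ℝ} {C : ℝ}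
    (hC : ∀ k, |g k| ≤ C) (a b : ℝ) :
    IntervalIntegrable (fun s : ℝ => g (n s.toNNReal)) volume a b := by
  rw [intervalIntegrable_iff]
  have hm : Measurable fun s : ℝ => g (n s.toNNReal) :=
    (Measurable.of_discrete (f := g)).comp
      (hn.comp fun x y h => Real.toNNReal_le_toNNReal h).measurable
  exact Measure.integrableOn_of_bounded (M := C) (by simp) hm.aestronglyMeasurable
    (.of_forall fun x => hC _)

theorem riemannPrimitive_comp_counting {n : ℝ≥0 → ℕ}
    (hn : ∀ t, ContinuousWithinAt n (Set.Ici t) t) {g : ℕ → ℝ} {C : ℝ} (hC : ∀ k, |g k| ≤ C)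
    (t : ℝ≥0) :
    riemannPrimitive (fun s => g (n s)) t = ∫ s in (0 : ℝ)..t, g (n s.toNNReal) :=
  riemannPrimitive_eq_integral (fun _ => hC _)
    (fun x => (continuous_of_discreteTopology (f := g)).continuousAt.comp_continuousWithinAt
      (hn x)) t

theorem sign_mul_neg_one_pow {x : ℝ} (hx : x = 1 ∨ x = -1) (k : ℕ) :
    x * (-1) ^ k = 1 ∨ x * (-1) ^ k = -1 := by
  rcases hx with rfl | rfl <;> rcases neg_one_pow_eq_or ℝ k with h | h <;> simp [h]

theorem abs_mul_sign_le {x : ℝ} (hx : x = 1 ∨ x = -1) (v : ℝ) : |v * x| ≤ |v| := by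
  rcases hx with rfl | rfl <;> simp

/-- The velocities along the diagonals as a function of the signs, integrated. -/
noncomputable def diagonalPositions (v : ℝ) (z : ℝ≥0 → ℝ × ℝ) : (ℝ≥0 → ℝ) × (ℝ≥0 → ℝ) :=
  (riemannPrimitive fun s => v * (z s).1, riemannPrimitive fun s => v * (z s).2)

theorem measurable_diagonalPositions (v : ℝ) : Measurable (diagonalPositions v) :=
  (measurable_riemannPrimitive.comp (by fun_prop)).prodMk
    (measurable_riemannPrimitive.comp (by fun_prop))

/-- The planar path with given components along the diagonals. -/
def planarPath (w : (ℝ≥0 → ℝ) × (ℝ≥0 → ℝ)) (t : ℝ≥0) : ℝ × ℝ := (w.1 t + w.2 t, w.1 t - w.2 t)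

theorem measurable_planarPath : Measurable planarPath := by
  refine measurable_pi_lambda _ fun t => ?_
  have h1 : Measurable fun w : (ℝ≥0 → ℝ) × (ℝ≥0 → ℝ) => w.1 t :=
    (measurable_pi_apply t).comp measurable_fst
  have h2 : Measurable fun w : (ℝ≥0 → ℝ) × (ℝ≥0 → ℝ) => w.2 t :=
    (measurable_pi_apply t).comp measurable_snd
  exact (h1.add h2).prodMk (h1.sub h2)

/-- Only almost every path is monotone and right-continuous, so the integrals agree with the
measurable functional almost surely, which is enough for laws. -/
theorem planarMotion_ae_eq {Ω : Type*} [MeasurableSpace Ω] {P : Measure Ω} {X Y : ℝ≥0 → Ω → ℝ}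
    {c r : ℝ} {E : ℕ → Ω → ZMod 4} {N : ℝ≥0 → Ω → ℕ} (hN : IsPoissonProcess N r P)
    (h : ∀ᵐ ω ∂P, ∀ t : ℝ≥0,
      X t ω = (∫ s in (0 : ℝ)..t,
        c * Real.cos (Real.pi * ((E (N s.toNNReal ω) ω).val : ℝ) / 2)) ∧
      Y t ω = (∫ s in (0 : ℝ)..t,
        c * Real.sin (Real.pi * ((E (N s.toNNReal ω) ω).val : ℝ) / 2))) :
    (fun ω t => (X t ω, Y t ω)) =ᵐ[P] fun ω => planarPath (diagonalPositions (c / 2)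
      fun t => (uSign (E (N t ω) ω), vSign (E (N t ω) ω))) := by
  filter_upwards [h, hN.monotone, hN.rightContinuous] with ω hω hm hc
  funext t
  have hu (k : ℕ) : |c / 2 * uSign (E k ω)| ≤ |c / 2| := abs_mul_sign_le (uSign_eq _) _
  have hv (k : ℕ) : |c / 2 * vSign (E k ω)| ≤ |c / 2| := abs_mul_sign_le (vSign_eq _) _
  have iu := intervalIntegrable_comp_monotone hm hu 0 t
  have iv := intervalIntegrable_comp_monotone hm hv 0 t
  simp only [planarPath, diagonalPositions]
  rw [(hω t).1, (hω t).2, riemannPrimitive_comp_counting hc hu,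
    riemannPrimitive_comp_counting hc hv, ← intervalIntegral.integral_add iu iv,
    ← intervalIntegral.integral_sub iu iv]
  simp only [cos_direction, sin_direction]
  congr 2 <;> funext s <;> ring

theorem telegraph_ae_eq {Ω : Type*} [MeasurableSpace Ω] {P : Measure Ω} {U : ℝ≥0 → Ω → ℝ}
    {v r : ℝ} {S : Ω → ℝ} {N : ℝ≥0 → Ω → ℕ} (hS : ∀ᵐ ω ∂P, S ω = 1 ∨ S ω = -1)
    (hN : IsPoissonProcess N r P)
    (h : ∀ᵐ ω ∂P, ∀ t : ℝ≥0, U t ω = ∫ s in (0 : ℝ)..t, v * (S ω * (-1) ^ N s.toNNReal ω)) :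
    (fun ω t => U t ω) =ᵐ[P] fun ω => riemannPrimitive fun t => v * (S ω * (-1) ^ N t ω) := by
  filter_upwards [h, hS, hN.rightContinuous] with ω hω hs hc
  funext t
  rw [hω t, riemannPrimitive_comp_counting hc (g := fun k => v * (S ω * (-1) ^ k))
    fun k => abs_mul_sign_le (sign_mul_neg_one_pow hs k) v]

theorem measurable_telegraphSign {Ω : Type*} [MeasurableSpace Ω] {P : Measure Ω} {r : ℝ}
    {S : Ω → ℝ} {N : ℝ≥0 → Ω → ℕ} (hS : Measurable S) (hN : IsPoissonProcess N r P) (t : ℝ≥0) :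
    Measurable fun ω => S ω * (-1) ^ N t ω :=
  hS.mul ((Measurable.of_discrete (f := fun k : ℕ => (-1 : ℝ) ^ k)).comp (hN.measurable t))

theorem identDistrib_prod_of_indepFun {Ω α β : Type*} [MeasurableSpace Ω] [MeasurableSpace α]
    [MeasurableSpace β] {P : Measure Ω} [IsProbabilityMeasure P] {f : Ω → α} {g : Ω → β}
    (hf : Measurable f) (hg : Measurable g) (h : IndepFun f g P) :
    IdentDistrib (fun z : Ω × Ω => (f z.1, g z.2)) (fun ω => (f ω, g ω)) (P.prod P) P where
  aemeasurable_fst := ((hf.comp measurable_fst).prodMk (hg.comp measurable_snd)).aemeasurable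
  aemeasurable_snd := (hf.prodMk hg).aemeasurable
  map_eq := by
    rw [(indepFun_iff_map_prod_eq_prod_map_map hf.aemeasurable hg.aemeasurable).1 h,
      Measure.map_prod_map P P hf hg]
    rfl

/-! ### Equality in law of the two motions -/

theorem theorem2 {Ω Ω' : Type*} [MeasurableSpace Ω] [MeasurableSpace Ω']
    (P : Measure Ω) [IsProbabilityMeasure P] (P' : Measure Ω') [IsProbabilityMeasure P']
    (c lam p : ℝ) (hc : 0 < c) (hlam : 0 < lam) (hp0 : 0 < p) (hp1 : p < 1)
    (X Y : ℝ≥0 → Ω → ℝ) (hXY : IsOrthogonalPlanarMotion X Y c lam p P)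
    (U V : ℝ≥0 → Ω' → ℝ)
    (hU : IsTelegraphProcess U (c / 2) (lam * (1 - p)) P')
    (hV : IsTelegraphProcess V (c / 2) (lam * p) P')
    (hUV : IndepFun (fun ω t => U t ω) (fun ω t => V t ω) P') :
    -- equality in law of the two planar processes, on the space of paths
    IdentDistrib (fun ω (t : ℝ≥0) => (X t ω, Y t ω))
      (fun ω (t : ℝ≥0) => (U t ω + V t ω, U t ω - V t ω)) P P' ∧
    -- in particular, equality of the joint characteristic functions at each fixed time
    ∀ (t : ℝ≥0) (α β : ℝ),
      ∫ ω, Complex.exp (Complex.I * ((α * X t ω + β * Y t ω : ℝ) : ℂ)) ∂P =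
        ∫ ω, Complex.exp
          (Complex.I * ((α * (U t ω + V t ω) + β * (U t ω - V t ω) : ℝ) : ℂ)) ∂P' := by
  obtain ⟨E, N, hE, hN, hEN, hXY⟩ := hXY
  obtain ⟨S, M, hS, hS1, hS2, hM, hSM, hU⟩ := hU
  obtain ⟨T, K, hT, hT1, hT2, hK, hTK, hV⟩ := hV
  have hS' := ae_eq_one_or_neg_one hS hS1 hS2
  have hT' := ae_eq_one_or_neg_one hT hT1 hT2
  have hU' := telegraph_ae_eq hS' hM hU
  have hV' := telegraph_ae_eq hT' hK hV
  have hUm : Measurable fun ω => riemannPrimitive fun t => c / 2 * (S ω * (-1) ^ M t ω) :=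
    measurable_riemannPrimitive.comp (measurable_pi_lambda _ fun t =>
      (measurable_telegraphSign hS hM t).const_mul _)
  have hVm : Measurable fun ω => riemannPrimitive fun t => c / 2 * (T ω * (-1) ^ K t ω) :=
    measurable_riemannPrimitive.comp (measurable_pi_lambda _ fun t =>
      (measurable_telegraphSign hT hK t).const_mul _)
  have hsign (f : ZMod 4 → ℝ) (t : ℝ≥0) : Measurable fun ω => f (E (N t ω) ω) :=
    (Measurable.of_discrete (f := f)).comp (measurable_eval_nat.comp
      ((measurable_pi_lambda (fun ω n => E n ω) hE.measurable).prodMk (hN.measurable t)))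
  have hlaw := (hasFlipMoments_planarMotion hlam.le hE hN hEN).identDistrib
    (hasFlipMoments_prod_telegraph (mul_nonneg hlam.le (sub_nonneg.2 hp1.le))
      (mul_nonneg hlam.le hp0.le) hS hS1 hS2 hT hT1 hT2 hM hK hSM hTK)
    (hsign uSign) (hsign vSign) (.of_forall fun ω t => uSign_eq _) (.of_forall fun ω t => vSign_eq _)
    (fun t => (measurable_telegraphSign hS hM t).comp measurable_fst)
    (fun t => (measurable_telegraphSign hT hK t).comp measurable_snd)
    (by
      filter_upwards [Measure.quasiMeasurePreserving_fst.ae hS'] with ω h t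
      exact sign_mul_neg_one_pow h _)
    (by
      filter_upwards [Measure.quasiMeasurePreserving_snd.ae hT'] with ω h t
      exact sign_mul_neg_one_pow h _)
  have hmotion := hlaw.comp (measurable_planarPath.comp (measurable_diagonalPositions (c / 2)))
  -- Independence is assumed for the paths of `U` and `V`, not jointly for the pairs (`S`, `M`) and
  -- (`T`, `K`) driving them. The sign laws are therefore compared on `P'.prod P'`, and the return
  -- to `P'` is made at the level of positions.
  have hdiag := (identDistrib_prod_of_indepFun hUm hVm (hUV.congr hU' hV')).comp
    measurable_planarPath
  have hXY' := planarMotion_ae_eq hN hXY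
  have hUVae : (fun ω (t : ℝ≥0) => (U t ω + V t ω, U t ω - V t ω)) =ᵐ[P'] planarPath ∘ fun ω =>
      (riemannPrimitive fun t => c / 2 * (S ω * (-1) ^ M t ω),
        riemannPrimitive fun t => c / 2 * (T ω * (-1) ^ K t ω)) := by
    filter_upwards [hU', hV'] with ω h1 h2
    rw [Function.comp_apply, ← h1, ← h2]
    rfl
  have hident : IdentDistrib (fun ω (t : ℝ≥0) => (X t ω, Y t ω))
      (fun ω (t : ℝ≥0) => (U t ω + V t ω, U t ω - V t ω)) P P' :=
    (IdentDistrib.of_ae_eq hmotion.aemeasurable_fst hXY'.symm).symm.trans (hmotion.trans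
      (hdiag.trans (IdentDistrib.of_ae_eq hdiag.aemeasurable_snd hUVae.symm)))
  refine ⟨hident, fun t α β => ?_⟩
  have hφ : Measurable fun z : ℝ≥0 → ℝ × ℝ =>
      Complex.exp (Complex.I * ((α * (z t).1 + β * (z t).2 : ℝ) : ℂ)) := by
    fun_prop
  exact (hident.comp hφ).integral_eq
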